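/- Let $\pi:\mathbb{R}^n\to(\mathbb{R}/\mathbb{Z})^n$ be the quotient map. For a nonempty closed set $X\subseteq(\mathbb{R}/\mathbb{Z})^n$, let $D(X)$ be the $L^\infty$-distance from $X$ to the point $(1/2,\dots,1/2)$, and call $X$ *proper* if it is not contained in the union of the coordinate hyperplanes $\{x_i=0\}$, $1\le i\le n$. A $k$-dimensional subtorus of $(\mathbb{R}/\mathbb{Z})^n$ is the image under $\pi$ of the real span of $k$ linearly independent vectors of $\mathbb{Z}^n$; a closed subgroup of $(\mathbb{R}/\mathbb{Z})^n$ has dimension $k$ if it is the direct product of a $k$-dimensional subtorus and a finite subgroup. Let $\mathcal{S}_k(n)$ (respectively $\mathcal{S}^*_k(n)$) be the set of all values $D(\Delta)$, where $\Delta$ ranges over the $k$-dimensional proper subtori (respectively the $k$-dimensional proper closed subgroups) of $(\mathbb{R}/\mathbb{Z})^n$, and write $\mathcal{S}(n)=\mathcal{S}_1(n)$ and $\mathcal{S}^*(n)=\mathcal{S}^*_1(n)$. **Proposition 8.1.** The cyclic subgroup $\pi(\langle(12/25,\,9/25)\rangle_{\mathbb{Z}})$ of $(\mathbb{R}/\mathbb{Z})^2$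 is a $0$-dimensional proper closed subgroup with $D\big(\pi(\langle(12/25,\,9/25)\rangle_{\mathbb{Z}})\big)=7/50$. Consequently $7/50\in\mathcal{S}^*_0(2)$, whereas $7/50\notin\mathcal{S}_1(3)$; that is, $7/50\in\mathcal{S}_0^*(2)\setminus\mathcal{S}_1(3)$. Moreover $7/50\in\mathcal{S}^*(3)$, and hence $\mathcal{S}(3)\subsetneq\mathcal{S}^*(3)$. -/

import Mathlib

namespace LonelyRunner

/-- The torus `(ℝ/ℤ)ⁿ`. Its metric is the `L^∞`-metric, each factor `ℝ/ℤ` carrying the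
distance induced from `ℝ`. -/
abbrev Torus (n : ℕ) : Type := Fin n → UnitAddCircle

/-- The quotient map `π : ℝⁿ → (ℝ/ℤ)ⁿ`. -/
def proj (n : ℕ) : (Fin n → ℝ) →+ Torus n where
  toFun x := fun i => (x i : UnitAddCircle)
  map_zero' := by
    funext i
    exact QuotientAddGroup.mk_zero _
  map_add' x y := by
    funext i
    exact AddCircle.coe_add (1 : ℝ) (x i) (y i)

/-- The center `(1/2, …, 1/2)` of `(ℝ/ℤ)ⁿ`. -/
noncomputable def center (n : ℕ) : Torus n := proj n (fun _ => 1 / 2)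

/-- `D(X)`: the `L^∞`-distance from the set `X` to the point `(1/2, …, 1/2)`. -/
noncomputable def D {n : ℕ} (X : Set (Torus n)) : ℝ := Metric.infDist (center n) X

/-- `X` is proper if it is not contained in the union of the coordinate hyperplanes. -/
def IsProper {n : ℕ} (X : Set (Torus n)) : Prop :=
  ¬ X ⊆ ⋃ i : Fin n, {x : Torus n | x i = 0}

/-- `T` is a `k`-dimensional (closed) subtorus of `(ℝ/ℤ)ⁿ`: the image under `π` of the real span
of `k` linearly independent integer vectors. -/
def IsSubtorus {n : ℕ} (k : ℕ) (T : AddSubgroup (Torus n)) : Prop :=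
  ∃ u : Fin k → Fin n → ℤ, LinearIndependent ℝ (fun j i => (u j i : ℝ)) ∧
    T = (Submodule.span ℝ (Set.range fun j i => (u j i : ℝ))).toAddSubgroup.map (proj n)

/-- `Δ` is a closed subgroup of `(ℝ/ℤ)ⁿ` of dimension `k`: the internal direct product of a
`k`-dimensional subtorus and a finite subgroup. -/
def IsClosedSubgroupOfDim {n : ℕ} (k : ℕ) (Δ : AddSubgroup (Torus n)) : Prop :=
  IsClosed (Δ : Set (Torus n)) ∧
    ∃ T F : AddSubgroup (Torus n), IsSubtorus k T ∧ (F : Set (Torus n)).Finite ∧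
      T ⊓ F = ⊥ ∧ Δ = T ⊔ F

/-- `𝒮_k(n)`: the values `D(T)` over the `k`-dimensional proper subtori `T` of `(ℝ/ℤ)ⁿ`. -/
def S (k n : ℕ) : Set ℝ :=
  {d | ∃ T : AddSubgroup (Torus n),
    IsSubtorus k T ∧ IsProper (T : Set (Torus n)) ∧ D (T : Set (Torus n)) = d}

/-- `𝒮*_k(n)`: the values `D(Δ)` over the `k`-dimensional proper closed subgroups `Δ` of
`(ℝ/ℤ)ⁿ`. -/
def SStar (k n : ℕ) : Set ℝ :=
  {d | ∃ Δ : AddSubgroup (Torus n),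
    IsClosedSubgroupOfDim k Δ ∧ IsProper (Δ : Set (Torus n)) ∧ D (Δ : Set (Torus n)) = d}

/-- The cyclic subgroup `π(⟨(12/25, 9/25)⟩_ℤ)` of `(ℝ/ℤ)²`. -/
noncomputable def witness : AddSubgroup (Torus 2) :=
  (AddSubgroup.zmultiples (![12 / 25, 9 / 25] : Fin 2 → ℝ)).map (proj 2)

end LonelyRunner

namespace LonelyRunner

/-! ### The norm on the circle -/

/-! Each coordinate of a point has distance `1/2 - ‖x i‖` from `1/2`, so `D X = 7/50` says that the
maximum over `X` of the smallest coordinate norm is `9/25`.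

Suppose a proper subtorus `{s • u}` of `(ℝ/ℤ)³` had this value, attained at `t`. If only one norm
were equal to `9/25` there, a small move along the line would raise it and keep the others above
(`exists_forall_lt_norm`). So two coordinates have norm exactly `9/25`. Replace `t` by `k * t` with
`k` from a fixed list: those two rise strictly above `9/25` (`lt_norm_multiplier`), and some such
`k` keeps the third at least `9/25` (`exists_multiplier_le_norm`). A small move again beats the
maximum.

Closed subgroups escape this argument because a finite group allows no small moves. A check modulo
25 gives `D_witness`, and a product with a free circle carries the value to dimension one in
`(ℝ/ℤ)³`. -/

lemma norm_coe_le (x : ℝ) (n : ℤ) : ‖(x : UnitAddCircle)‖ ≤ |x - n| := by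
  rw [UnitAddCircle.norm_eq]
  exact round_le x n

lemma le_norm_coe {x r : ℝ} (n : ℤ) (h₁ : n + r ≤ x) (h₂ : x ≤ n + 1 - r) :
    r ≤ ‖(x : UnitAddCircle)‖ := by
  rw [UnitAddCircle.norm_eq]
  rcases le_or_gt (round x) n with h | h
  · have : (round x : ℝ) ≤ n := by exact_mod_cast h
    exact le_trans (by linarith) (le_abs_self _)
  · have : (n : ℝ) + 1 ≤ round x := by exact_mod_cast h
    exact le_trans (by linarith) (neg_le_abs _)

lemma lt_norm_coe {x r : ℝ} (n : ℤ) (h₁ : n + r < x) (h₂ : x < n + 1 - r) :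
    r < ‖(x : UnitAddCircle)‖ := by
  have h := le_norm_coe (x := x) (r := min (x - n) (n + 1 - x)) n
    (by linarith [min_le_left (x - n) (n + 1 - x)])
    (by linarith [min_le_right (x - n) (n + 1 - x)])
  exact lt_of_lt_of_le (lt_min (by linarith) (by linarith)) h

lemma norm_coe_eq_min (x : ℝ) :
    ‖(x : UnitAddCircle)‖ = min (x - ⌊x⌋) (⌊x⌋ + 1 - x) := by
  have h₀ := Int.floor_le x
  have h₁ := Int.lt_floor_add_one x
  apply le_antisymm
  · apply le_min
    · exact (norm_coe_le x ⌊x⌋).trans_eq (abs_of_nonneg (sub_nonneg.2 h₀))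
    · have := norm_coe_le x (⌊x⌋ + 1)
      push_cast at this
      rwa [abs_of_nonpos (by linarith), neg_sub] at this
  · exact le_norm_coe ⌊x⌋ (by linarith [min_le_left (x - ⌊x⌋) (⌊x⌋ + 1 - x)])
      (by linarith [min_le_right (x - ⌊x⌋) (⌊x⌋ + 1 - x)])

/-- Every point lies on a shortest arc between the antipodes `0` and `1/2`, so its distances to them
add up to `1/2`. -/
lemma norm_half_sub (x : UnitAddCircle) :
    ‖((1 / 2 : ℝ) : UnitAddCircle) - x‖ = 1 / 2 - ‖x‖ := by
  obtain ⟨x, rfl⟩ := QuotientAddGroup.mk_surjective x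
  change ‖((1 / 2 : ℝ) : UnitAddCircle) - (x : UnitAddCircle)‖ = 1 / 2 - ‖(x : UnitAddCircle)‖
  have h₀ := Int.floor_le x
  have h₁ := Int.lt_floor_add_one x
  rw [← AddCircle.coe_sub, norm_coe_eq_min x]
  apply le_antisymm
  · have h := norm_coe_le (1 / 2 - x) (-⌊x⌋)
    push_cast at h
    refine h.trans (abs_le.2 ?_)
    rcases min_cases (x - ⌊x⌋) (⌊x⌋ + 1 - x) with ⟨h, h'⟩ | ⟨h, h'⟩ <;> rw [h] <;>
      constructor <;> linarith
  · rcases min_cases (x - ⌊x⌋) (⌊x⌋ + 1 - x) with ⟨h, h'⟩ | ⟨h, h'⟩ <;> rw [h]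
    · exact le_norm_coe (-⌊x⌋) (by push_cast; linarith) (by push_cast; linarith)
    · exact le_norm_coe (-⌊x⌋ - 1) (by push_cast; linarith) (by push_cast; linarith)

lemma exists_int_add_or_sub_of_norm_eq {x r : ℝ} (h : ‖(x : UnitAddCircle)‖ = r) :
    ∃ n : ℤ, x = n + r ∨ x = n - r := by
  rw [norm_coe_eq_min] at h
  rcases min_choice (x - ⌊x⌋) (⌊x⌋ + 1 - x) with h' | h' <;> rw [h'] at h
  · exact ⟨⌊x⌋, Or.inl (by linarith)⟩
  · exact ⟨⌊x⌋ + 1, Or.inr (by push_cast; linarith)⟩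

lemma exists_int_add_of_le_norm {x r : ℝ} (h : r ≤ ‖(x : UnitAddCircle)‖) :
    ∃ n : ℤ, n + r ≤ x ∧ x ≤ n + 1 - r := by
  rw [norm_coe_eq_min, le_min_iff] at h
  exact ⟨⌊x⌋, by linarith [h.1], by linarith [h.2]⟩

/-! ### Distance to the center -/

lemma dist_center_le_iff {n : ℕ} (x : Torus n) {r : ℝ} (hr : 0 ≤ r) :
    dist (center n) x ≤ r ↔ ∀ i, 1 / 2 - r ≤ ‖x i‖ := by
  rw [dist_pi_le_iff hr]
  refine forall_congr' fun i => ?_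
  have : dist (center n i) (x i) = 1 / 2 - ‖x i‖ := by
    rw [dist_eq_norm]
    exact norm_half_sub (x i)
  rw [this]
  constructor <;> intro h <;> linarith

lemma D_eq_of_forall_exists {n : ℕ} {X : Set (Torus n)} {r : ℝ} (hr : 0 < r) {x : Torus n}
    (hx : x ∈ X) (hxr : ∀ i, 1 / 2 - r ≤ ‖x i‖)
    (hX : ∀ y ∈ X, ∃ i, ‖y i‖ ≤ 1 / 2 - r) : D X = r := by
  apply le_antisymm
  · exact (Metric.infDist_le_dist_of_mem hx).trans ((dist_center_le_iff x hr.le).2 hxr)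
  · refine (Metric.le_infDist ⟨x, hx⟩).2 fun y hy => ?_
    obtain ⟨i, hi⟩ := hX y hy
    have h := (dist_center_le_iff y dist_nonneg).1 le_rfl i
    linarith

lemma exists_forall_le_norm_of_D_eq {n : ℕ} {X : Set (Torus n)} {r : ℝ} (hX : IsCompact X)
    (hne : X.Nonempty) (h : D X = r) : ∃ x ∈ X, ∀ i, 1 / 2 - r ≤ ‖x i‖ := by
  obtain ⟨x, hx, hd⟩ := hX.exists_infDist_eq_dist hne (center n)
  have h' : dist (center n) x = r := by rw [← hd]; exact h
  exact ⟨x, hx, (dist_center_le_iff x (h' ▸ dist_nonneg)).1 h'.le⟩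

lemma exists_norm_le_of_D_eq {n : ℕ} [NeZero n] {X : Set (Torus n)} {r : ℝ} (h : D X = r)
    {x : Torus n} (hx : x ∈ X) : ∃ i, ‖x i‖ ≤ 1 / 2 - r := by
  by_contra! hlt
  obtain ⟨j, -, hj⟩ := Finset.exists_min_image Finset.univ (fun i => ‖x i‖)
    ⟨(0 : Fin n), Finset.mem_univ _⟩
  have hhalf : ‖x j‖ ≤ 1 / 2 := by
    have := norm_nonneg (((1 / 2 : ℝ) : UnitAddCircle) - x j)
    rw [norm_half_sub] at this
    linarith
  have hd : dist (center n) x ≤ 1 / 2 - ‖x j‖ :=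
    (dist_center_le_iff x (by linarith)).2 fun i => by
      linarith [hj i (Finset.mem_univ i)]
  have hD : D X ≤ dist (center n) x := Metric.infDist_le_dist_of_mem hx
  linarith [hlt j]

/-! ### One-dimensional subtori -/

lemma IsSubtorus.exists_direction {n : ℕ} {T : AddSubgroup (Torus n)} (hT : IsSubtorus 1 T) :
    ∃ u : Fin n → ℤ, ∀ x, x ∈ T ↔ ∃ s : ℝ, (fun i => ((s * u i : ℝ) : UnitAddCircle)) = x := by
  obtain ⟨u, -, rfl⟩ := hT
  refine ⟨u 0, fun x => ?_⟩
  have hr : (Set.range fun (j : Fin 1) i => (u j i : ℝ)) = {fun i => (u 0 i : ℝ)} := by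
    ext y
    simp [eq_comm]
  rw [hr, AddSubgroup.mem_map]
  constructor
  · rintro ⟨y, hy, rfl⟩
    obtain ⟨s, rfl⟩ := Submodule.mem_span_singleton.1 hy
    exact ⟨s, rfl⟩
  · rintro ⟨s, rfl⟩
    exact ⟨s • fun i => (u 0 i : ℝ), Submodule.mem_span_singleton.2 ⟨s, rfl⟩, rfl⟩

/-- Since the direction is integral, `s ↦ s • u` factors through the compact circle. Compactness is
what makes `D` attained. -/
lemma IsSubtorus.isCompact {n : ℕ} {T : AddSubgroup (Torus n)} (hT : IsSubtorus 1 T) :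
    IsCompact (T : Set (Torus n)) := by
  obtain ⟨u, hu⟩ := hT.exists_direction
  have hc : Continuous fun (s : UnitAddCircle) (i : Fin n) => u i • s := by fun_prop
  convert isCompact_range hc
  ext x
  have hsmul (s : ℝ) (i : Fin n) :
      u i • (s : UnitAddCircle) = ((s * u i : ℝ) : UnitAddCircle) := by
    rw [← AddCircle.coe_zsmul, zsmul_eq_mul, mul_comm]
  constructor
  · intro h
    obtain ⟨s, rfl⟩ := (hu x).1 h
    exact ⟨(s : UnitAddCircle), funext fun i => hsmul s i⟩
  · rintro ⟨s, rfl⟩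
    obtain ⟨s, rfl⟩ := QuotientAddGroup.mk_surjective s
    exact (hu _).2 ⟨s, (funext fun i => hsmul s i).symm⟩

lemma IsSubtorus.isClosedSubgroupOfDim {n : ℕ} {T : AddSubgroup (Torus n)}
    (hT : IsSubtorus 1 T) : IsClosedSubgroupOfDim 1 T :=
  ⟨hT.isCompact.isClosed, T, ⊥, hT, by simp, by simp, by simp⟩

lemma S_one_subset_SStar_one (n : ℕ) : S 1 n ⊆ SStar 1 n := fun _ ⟨T, hT, hp, hd⟩ =>
  ⟨T, hT.isClosedSubgroupOfDim, hp, hd⟩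

/-! ### The value `7/50` is not attained on one-dimensional subtori of `(ℝ/ℤ)³` -/

/-- A point of a one-parameter line with exactly one coordinate of norm `r` can be moved so
that all coordinates have norm greater than `r`. -/
lemma exists_forall_lt_norm {n : ℕ} {u : Fin n → ℤ} {r : ℝ} (hr : r < 1 / 2)
    {s : ℝ} {j : Fin n} (hu : u j ≠ 0) (hj : r ≤ ‖((s * u j : ℝ) : UnitAddCircle)‖)
    (h : ∀ i, i ≠ j → r < ‖((s * u i : ℝ) : UnitAddCircle)‖) :
    ∃ s' : ℝ, ∀ i, r < ‖((s' * u i : ℝ) : UnitAddCircle)‖ := by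
  rcases hj.lt_or_eq with hj | hj
  · exact ⟨s, fun i => if hi : i = j then hi ▸ hj else h i hi⟩
  have hu' : (u j : ℝ) ≠ 0 := by exact_mod_cast hu
  -- Dividing by `u j` makes coordinate `j` move by exactly `ε * δ`. The sign `ε` is chosen below to
  -- lead away from the nearest integer.
  have key (ε : ℝ) : ∀ᶠ δ : ℝ in nhdsWithin 0 (Set.Ioi 0), ∀ i, i ≠ j →
      r < ‖(((s + ε * δ / u j) * u i : ℝ) : UnitAddCircle)‖ := by
    refine Filter.Eventually.filter_mono nhdsWithin_le_nhds ?_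
    refine Filter.eventually_all.2 fun i => ?_
    by_cases hi : i = j
    · simp [hi]
    have hc : Continuous fun δ : ℝ => ‖(((s + ε * δ / u j) * u i : ℝ) : UnitAddCircle)‖ :=
      continuous_norm.comp ((AddCircle.continuous_mk' (1 : ℝ)).comp (by fun_prop))
    have h₀ : r < ‖(((s + ε * 0 / u j) * u i : ℝ) : UnitAddCircle)‖ := by
      rw [mul_zero, zero_div, add_zero]
      exact h i hi
    filter_upwards [(isOpen_lt continuous_const hc).mem_nhds h₀] with δ hδ _ using hδ
  have hsmall : ∀ᶠ δ : ℝ in nhdsWithin 0 (Set.Ioi 0), δ ∈ Set.Ioo 0 (1 / 2 - r) :=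
    Ioo_mem_nhdsGT (by linarith)
  obtain ⟨m, hm | hm⟩ := exists_int_add_or_sub_of_norm_eq hj.symm
  · obtain ⟨δ, hδ, hδ₀, hδ₁⟩ := ((key 1).and hsmall).exists
    refine ⟨s + 1 * δ / u j, fun i => ?_⟩
    by_cases hi : i = j
    · subst hi
      have : (s + 1 * δ / u i) * u i = m + r + δ := by rw [← hm]; field_simp
      rw [this]
      exact lt_norm_coe m (by linarith) (by linarith)
    · exact hδ i hi
  · obtain ⟨δ, hδ, hδ₀, hδ₁⟩ := ((key (-1)).and hsmall).exists
    refine ⟨s + -1 * δ / u j, fun i => ?_⟩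
    by_cases hi : i = j
    · subst hi
      have : (s + -1 * δ / u i) * u i = m - r - δ := by rw [← hm]; field_simp; ring
      rw [this]
      exact lt_norm_coe (m - 1) (by push_cast; linarith) (by push_cast; linarith)
    · exact hδ i hi

/-- Each `k` is good on windows `[(m + 9/25)/k, (m + 16/25)/k]`, and these cover `[9/25, 16/25]`,
symmetrically about `1/2`. The windows of 18 and 7 only touch at `12/25`, where no listed `k` gives
strict inequality. -/
lemma exists_multiplier_le_norm {x : ℝ} (hx : 9 / 25 ≤ ‖(x : UnitAddCircle)‖) :
    ∃ k : ℤ, k ∈ ({4, 7, 10, 15, 18, 29} : Finset ℤ) ∧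
      9 / 25 ≤ ‖((k * x : ℝ) : UnitAddCircle)‖ := by
  obtain ⟨n, h₁, h₂⟩ := exists_int_add_of_le_norm hx
  by_contra! hk
  have far (k : ℤ) (hmem : k ∈ ({4, 7, 10, 15, 18, 29} : Finset ℤ)) (m : ℤ) :
      (k : ℝ) * (x - n) < m + 9 / 25 ∨ (m : ℝ) + 16 / 25 < k * (x - n) := by
    by_contra! hcon
    refine (hk k hmem).not_ge (le_norm_coe (m + k * n) ?_ ?_) <;> push_cast <;> linarith
  have hy₁ : 9 / 25 ≤ x - n := by linarith
  have hy₂ : x - n ≤ 16 / 25 := by linarith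
  clear h₁ h₂ hk hx
  generalize x - n = y at far hy₁ hy₂
  rcases le_total y (1 / 2) with hy | hy
  · have h₄ := far 4 (by simp) 1
    have h₇ := far 7 (by simp) 3
    have h₁₀ := far 10 (by simp) 4
    have h₁₅ := far 15 (by simp) 6
    have h₁₈ := far 18 (by simp) 7
    have h₁₈' := far 18 (by simp) 8
    -- The window of 10 ends at `0.464` and that of 18 starts at `8.36/18 ≈ 0.4644`; 29 fills this
    -- gap.
    have h₂₉ := far 29 (by simp) 13
    clear far
    push_cast at *
    replace h₄ : 41 / 100 < y := by rcases h₄ with h | h <;> linarith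
    replace h₇ : y < 48 / 100 := by rcases h₇ with h | h <;> linarith
    rcases h₁₀ with h₁₀ | h₁₀
    · replace h₁₅ : y < 424 / 1000 := by rcases h₁₅ with h | h <;> linarith
      rcases h₁₈ with h | h <;> linarith
    · replace h₁₈' : y < 4645 / 10000 := by rcases h₁₈' with h | h <;> linarith
      rcases h₂₉ with h | h <;> linarith
  · have h₄ := far 4 (by simp) 2
    have h₇ := far 7 (by simp) 3
    have h₁₀ := far 10 (by simp) 5
    have h₁₅ := far 15 (by simp) 8
    have h₁₈ := far 18 (by simp) 10
    have h₁₈' := far 18 (by simp) 9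
    have h₂₉ := far 29 (by simp) 15
    clear far
    push_cast at *
    replace h₄ : y < 59 / 100 := by rcases h₄ with h | h <;> linarith
    replace h₇ : 52 / 100 < y := by rcases h₇ with h | h <;> linarith
    rcases h₁₀ with h₁₀ | h₁₀
    · replace h₁₈' : 5355 / 10000 < y := by rcases h₁₈' with h | h <;> linarith
      rcases h₂₉ with h | h <;> linarith
    · replace h₁₅ : 576 / 1000 < y := by rcases h₁₅ with h | h <;> linarith
      rcases h₁₈ with h | h <;> linarith

/-- The residues of `9 * k` modulo 25 are 11, 13, 15, 10, 12, 11, all strictly between 9 and 16;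
negating `x` reflects this range onto itself. -/
lemma lt_norm_multiplier {x : ℝ} (hx : ‖(x : UnitAddCircle)‖ = 9 / 25) {k : ℤ}
    (hk : k ∈ ({4, 7, 10, 15, 18, 29} : Finset ℤ)) :
    9 / 25 < ‖((k * x : ℝ) : UnitAddCircle)‖ := by
  have main (m : ℤ) (h₁ : 9 < 9 * k - 25 * m) (h₂ : 9 * k - 25 * m < 16) :
      9 / 25 < ‖((k * x : ℝ) : UnitAddCircle)‖ := by
    have h₁' : (9 : ℝ) < 9 * k - 25 * m := by exact_mod_cast h₁
    have h₂' : 9 * (k : ℝ) - 25 * m < 16 := by exact_mod_cast h₂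
    obtain ⟨n, rfl | rfl⟩ := exists_int_add_or_sub_of_norm_eq hx
    · refine lt_norm_coe (k * n + m) ?_ ?_ <;> push_cast <;> linarith
    · refine lt_norm_coe (k * n - m - 1) ?_ ?_ <;> push_cast <;> linarith
  simp only [Finset.mem_insert, Finset.mem_singleton] at hk
  rcases hk with rfl | rfl | rfl | rfl | rfl | rfl
  · exact main 1 (by norm_num) (by norm_num)
  · exact main 2 (by norm_num) (by norm_num)
  · exact main 3 (by norm_num) (by norm_num)
  · exact main 5 (by norm_num) (by norm_num)
  · exact main 6 (by norm_num) (by norm_num)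
  · exact main 10 (by norm_num) (by norm_num)

lemma seven_div_fifty_not_mem_S_one_three : (7 / 50 : ℝ) ∉ S 1 3 := by
  rintro ⟨T, hT, hproper, hD⟩
  have hcompact := hT.isCompact
  obtain ⟨u, hmem⟩ := hT.exists_direction
  have hu : ∀ i, u i ≠ 0 := by
    intro i hi
    refine hproper fun x hx => Set.mem_iUnion.2 ⟨i, ?_⟩
    obtain ⟨s, rfl⟩ := (hmem x).1 hx
    simp [hi]
  have hhalf : (1 / 2 - 7 / 50 : ℝ) = 9 / 25 := by norm_num
  obtain ⟨x, hx, hxle⟩ := exists_forall_le_norm_of_D_eq hcompact ⟨0, T.zero_mem⟩ hD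
  obtain ⟨t, rfl⟩ := (hmem x).1 hx
  simp only [hhalf] at hxle
  have hmax (s : ℝ) : ¬ ∀ i, 9 / 25 < ‖((s * u i : ℝ) : UnitAddCircle)‖ := by
    intro hs
    obtain ⟨i, hi⟩ := exists_norm_le_of_D_eq hD ((hmem _).2 ⟨s, rfl⟩)
    rw [hhalf] at hi
    exact (hs i).not_ge hi
  -- At most one coordinate exceeds `9/25` at `t`, for otherwise `t` could be improved.
  obtain ⟨j, hj⟩ : ∃ j, ∀ i, i ≠ j → ‖((t * u i : ℝ) : UnitAddCircle)‖ = 9 / 25 := by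
    by_contra! hcon
    have hlt {i : Fin 3} (h : ‖((t * u i : ℝ) : UnitAddCircle)‖ ≠ 9 / 25) :
        9 / 25 < ‖((t * u i : ℝ) : UnitAddCircle)‖ := lt_of_le_of_ne (hxle i) (Ne.symm h)
    -- The index `0` is arbitrary: any coordinate of norm other than `9/25` serves as `a`.
    obtain ⟨a, -, ha⟩ := hcon 0
    obtain ⟨b, hba, hb⟩ := hcon a
    obtain ⟨c, hca, hcb⟩ : ∃ c : Fin 3, c ≠ a ∧ c ≠ b := by
      clear * -
      revert a b
      decide
    obtain ⟨s, hs⟩ := exists_forall_lt_norm (by norm_num) (hu c) (hxle c)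
      fun i hi => by
        obtain rfl | rfl : i = a ∨ i = b := by
          clear * - hi hca hcb hba
          omega
        · exact hlt ha
        · exact hlt hb
    exact hmax s hs
  obtain ⟨k, hk, hkj⟩ := exists_multiplier_le_norm (hxle j)
  -- At `k * t` only coordinate `j` can still have norm exactly `9/25`.
  obtain ⟨s, hs⟩ := exists_forall_lt_norm (r := 9 / 25) (s := k * t) (by norm_num) (hu j)
    (by rwa [mul_assoc]) fun i hi => by
      rw [mul_assoc]
      exact lt_norm_multiplier (hj i hi) hk
  exact hmax s hs

/-! ### The cyclic group of order 25 -/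

lemma mem_witness {x : Torus 2} :
    x ∈ witness ↔ ∃ k : ℤ, proj 2 ![k * (12 / 25), k * (9 / 25)] = x := by
  simp only [witness, AddSubgroup.mem_map, AddSubgroup.mem_zmultiples_iff]
  simp

lemma nsmul_eq_zero_of_mem_witness {x : Torus 2} (hx : x ∈ witness) : 25 • x = 0 := by
  obtain ⟨k, rfl⟩ := mem_witness.1 hx
  rw [← map_nsmul]
  funext i
  fin_cases i
  · change ((25 • (k * (12 / 25)) : ℝ) : UnitAddCircle) = 0
    exact (AddCircle.coe_eq_zero_iff _).2 ⟨12 * k, by simp; ring⟩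
  · change ((25 • (k * (9 / 25)) : ℝ) : UnitAddCircle) = 0
    exact (AddCircle.coe_eq_zero_iff _).2 ⟨9 * k, by simp; ring⟩

lemma witness_eq_zmultiples : witness = AddSubgroup.zmultiples (proj 2 ![12 / 25, 9 / 25]) :=
  AddMonoidHom.map_zmultiples _ _

lemma generator_mem_witness : proj 2 ![12 / 25, 9 / 25] ∈ witness := by
  rw [witness_eq_zmultiples]
  exact AddSubgroup.mem_zmultiples _

lemma finite_witness : (witness : Set (Torus 2)).Finite := by
  have h : IsOfFinAddOrder (proj 2 ![12 / 25, 9 / 25]) := isOfFinAddOrder_iff_nsmul_eq_zero.2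
    ⟨25, by norm_num, nsmul_eq_zero_of_mem_witness generator_mem_witness⟩
  rw [witness_eq_zmultiples]
  exact finite_zmultiples.2 h

lemma isSubtorus_zero_bot (n : ℕ) : IsSubtorus 0 (⊥ : AddSubgroup (Torus n)) :=
  ⟨fun j => j.elim0, linearIndependent_empty_type, by simp⟩

lemma isClosedSubgroupOfDim_witness : IsClosedSubgroupOfDim 0 witness :=
  ⟨finite_witness.isClosed, ⊥, witness, isSubtorus_zero_bot 2, finite_witness, by simp, by simp⟩

/-- The residue of `12 * k` modulo 25 lies in `10, …, 15` only for `k ≡ ±1, ±3, ±5`; then `9 * k` is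
congruent to `±9, ±2, ±5`. -/
lemma exists_norm_le_of_mem_witness {x : Torus 2} (hx : x ∈ witness) : ∃ i, ‖x i‖ ≤ 9 / 25 := by
  obtain ⟨k, rfl⟩ := mem_witness.1 hx
  have h : ∃ m : ℤ, (-9 ≤ 12 * k - 25 * m ∧ 12 * k - 25 * m ≤ 9) ∨
      (-9 ≤ 9 * k - 25 * m ∧ 9 * k - 25 * m ≤ 9) := by
    by_contra! hcon
    -- The integer nearest to a quotient is its floor or the next integer.
    have h₁ := hcon (12 * k / 25)
    have h₂ := hcon (12 * k / 25 + 1)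
    have h₃ := hcon (9 * k / 25)
    have h₄ := hcon (9 * k / 25 + 1)
    have hx : 10 ≤ 12 * k % 25 ∧ 12 * k % 25 ≤ 15 := by omega
    have hy : 10 ≤ 9 * k % 25 ∧ 9 * k % 25 ≤ 15 := by omega
    have : k % 25 < 25 ∧ 0 ≤ k % 25 := by omega
    clear * - hx hy this
    rw [Int.mul_emod] at hx hy
    generalize k % 25 = r at *
    obtain ⟨h, h'⟩ := this
    interval_cases r <;> simp at hx hy
  obtain ⟨m, ⟨h₁, h₂⟩ | ⟨h₁, h₂⟩⟩ := h
  · have h₁' : (-9 : ℝ) ≤ 12 * k - 25 * m := by exact_mod_cast h₁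
    have h₂' : 12 * (k : ℝ) - 25 * m ≤ 9 := by exact_mod_cast h₂
    refine ⟨0, (norm_coe_le (k * (12 / 25)) m).trans (abs_le.2 ⟨?_, ?_⟩)⟩ <;> linarith
  · have h₁' : (-9 : ℝ) ≤ 9 * k - 25 * m := by exact_mod_cast h₁
    have h₂' : 9 * (k : ℝ) - 25 * m ≤ 9 := by exact_mod_cast h₂
    refine ⟨1, (norm_coe_le (k * (9 / 25)) m).trans (abs_le.2 ⟨?_, ?_⟩)⟩ <;> linarith

lemma le_norm_generator (i : Fin 2) : 9 / 25 ≤ ‖proj 2 ![12 / 25, 9 / 25] i‖ := by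
  fin_cases i
  · exact le_norm_coe (x := 12 / 25) 0 (by norm_num) (by norm_num)
  · exact le_norm_coe (x := 9 / 25) 0 (by norm_num) (by norm_num)

lemma isProper_of_forall_lt_norm {n : ℕ} {X : Set (Torus n)} {x : Torus n} (hx : x ∈ X)
    (h : ∀ i, 0 < ‖x i‖) : IsProper X := fun hX => by
  obtain ⟨i, hi⟩ := Set.mem_iUnion.1 (hX hx)
  exact (h i).ne' (by rw [show x i = 0 from hi, norm_zero])

lemma isProper_witness : IsProper (witness : Set (Torus 2)) :=
  isProper_of_forall_lt_norm generator_mem_witness fun i =>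
    lt_of_lt_of_le (by norm_num) (le_norm_generator i)

lemma D_witness : D (witness : Set (Torus 2)) = 7 / 50 :=
  D_eq_of_forall_exists (by norm_num) generator_mem_witness
    (fun i => le_trans (by norm_num) (le_norm_generator i)) fun _ hy => by
      obtain ⟨i, hi⟩ := exists_norm_le_of_mem_witness hy
      exact ⟨i, hi.trans (by norm_num)⟩

/-! ### The product of the cyclic group with a circle -/

/-- The projection of `(ℝ/ℤ)³` to its first two coordinates. -/
def firstTwo : Torus 3 →+ Torus 2 where
  toFun x := ![x 0, x 1]
  map_zero' := by simp
  map_add' x y := by simp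

/-- The inclusion of `(ℝ/ℤ)²` into `(ℝ/ℤ)³` as the first two coordinates. -/
def extendZero : Torus 2 →+ Torus 3 where
  toFun x := ![x 0, x 1, 0]
  map_zero' := by
    funext i
    fin_cases i <;> rfl
  map_add' x y := by simp

/-- The product of the cyclic group with the third coordinate circle. -/
noncomputable def witnessProd : AddSubgroup (Torus 3) := witness.comap firstTwo

/-- The third coordinate circle. -/
noncomputable def thirdCircle : AddSubgroup (Torus 3) :=
  (Submodule.span ℝ
    (Set.range fun (_ : Fin 1) (i : Fin 3) => ((![0, 0, 1] : Fin 3 → ℤ) i : ℝ))).toAddSubgroup.map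
    (proj 3)

lemma isSubtorus_thirdCircle : IsSubtorus 1 thirdCircle := by
  refine ⟨fun _ => ![0, 0, 1], ?_, rfl⟩
  refine LinearIndependent.of_subsingleton 0 fun h => ?_
  simpa using congrFun h 2

lemma mem_thirdCircle {x : Torus 3} : x ∈ thirdCircle ↔ x 0 = 0 ∧ x 1 = 0 := by
  have hr : (Set.range fun (_ : Fin 1) (i : Fin 3) => ((![0, 0, 1] : Fin 3 → ℤ) i : ℝ)) =
      {fun i : Fin 3 => ((![0, 0, 1] : Fin 3 → ℤ) i : ℝ)} := Set.range_const
  rw [thirdCircle, hr, AddSubgroup.mem_map]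
  constructor
  · rintro ⟨y, hy, rfl⟩
    obtain ⟨s, rfl⟩ := Submodule.mem_span_singleton.1 hy
    constructor <;> simp [proj]
  · rintro ⟨h₀, h₁⟩
    obtain ⟨s, hs⟩ := QuotientAddGroup.mk_surjective (x 2)
    refine ⟨_, Submodule.mem_span_singleton.2 ⟨s, rfl⟩, ?_⟩
    funext i
    fin_cases i
    · simp [proj, h₀]
    · simp [proj, h₁]
    · simpa [proj] using hs

lemma witnessProd_eq_sup : witnessProd = thirdCircle ⊔ witness.map extendZero := by
  ext x
  rw [AddSubgroup.mem_sup]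
  constructor
  · intro hx
    refine ⟨![0, 0, x 2], mem_thirdCircle.2 ⟨rfl, rfl⟩, extendZero (firstTwo x),
      AddSubgroup.mem_map_of_mem _ hx, ?_⟩
    funext i
    fin_cases i <;> simp [extendZero, firstTwo]
  · rintro ⟨y, hy, _, ⟨w, hw, rfl⟩, rfl⟩
    obtain ⟨h₀, h₁⟩ := mem_thirdCircle.1 hy
    have : firstTwo (y + extendZero w) = w := by
      funext i
      fin_cases i
      · change y 0 + w 0 = w 0
        rw [h₀, zero_add]
      · change y 1 + w 1 = w 1
        rw [h₁, zero_add]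
    change firstTwo (y + extendZero w) ∈ witness
    rwa [this]

lemma thirdCircle_inf_witness : thirdCircle ⊓ witness.map extendZero = ⊥ := by
  rw [eq_bot_iff]
  rintro _ ⟨hx, w, -, rfl⟩
  obtain ⟨h₀, h₁⟩ := mem_thirdCircle.1 hx
  rw [AddSubgroup.mem_bot]
  funext i
  fin_cases i
  · exact h₀
  · exact h₁
  · rfl

lemma isClosedSubgroupOfDim_witnessProd : IsClosedSubgroupOfDim 1 witnessProd := by
  refine ⟨?_, thirdCircle, witness.map extendZero, isSubtorus_thirdCircle,
    finite_witness.image _, thirdCircle_inf_witness, witnessProd_eq_sup⟩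
  refine finite_witness.isClosed.preimage (f := firstTwo) ?_
  refine continuous_pi fun i => ?_
  fin_cases i
  · exact continuous_apply 0
  · exact continuous_apply 1

lemma seven_div_fifty_mem_SStar_one_three : (7 / 50 : ℝ) ∈ SStar 1 3 := by
  -- The third coordinate is free, so it takes the value `1/2` of largest norm and does not affect
  -- the minimum.
  set p : Torus 3 := ![proj 2 ![12 / 25, 9 / 25] 0, proj 2 ![12 / 25, 9 / 25] 1,
    ((1 / 2 : ℝ) : UnitAddCircle)] with hp
  have hmem : p ∈ witnessProd := by
    have : firstTwo p = proj 2 ![12 / 25, 9 / 25] := by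
      funext i
      fin_cases i <;> rfl
    change firstTwo p ∈ witness
    exact this ▸ generator_mem_witness
  have hle (i : Fin 3) : 9 / 25 ≤ ‖p i‖ := by
    fin_cases i
    · exact le_norm_generator 0
    · exact le_norm_generator 1
    · exact le_norm_coe (x := 1 / 2) 0 (by norm_num) (by norm_num)
  refine ⟨witnessProd, isClosedSubgroupOfDim_witnessProd,
    isProper_of_forall_lt_norm hmem fun i => lt_of_lt_of_le (by norm_num) (hle i),
    D_eq_of_forall_exists (by norm_num) hmem (fun i => le_trans (by norm_num) (hle i))
      fun y hy => ?_⟩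
  obtain ⟨i, hi⟩ := exists_norm_le_of_mem_witness hy
  have h : (1 / 2 - 7 / 50 : ℝ) = 9 / 25 := by norm_num
  rw [h]
  fin_cases i
  · exact ⟨0, hi⟩
  · exact ⟨1, hi⟩

end LonelyRunner

theorem proposition8p1 :
    -- the cyclic group generated by (12/25, 9/25) witnesses the value 7/50
    (LonelyRunner.IsClosedSubgroupOfDim 0 LonelyRunner.witness ∧
      LonelyRunner.IsProper (LonelyRunner.witness : Set (LonelyRunner.Torus 2)) ∧
      LonelyRunner.D (LonelyRunner.witness : Set (LonelyRunner.Torus 2)) = 7 / 50) ∧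
    ((7 / 50 : ℝ) ∈ LonelyRunner.SStar 0 2 ∧ (7 / 50 : ℝ) ∉ LonelyRunner.S 1 3) ∧
    ((7 / 50 : ℝ) ∈ LonelyRunner.SStar 1 3 ∧
      LonelyRunner.S 1 3 ⊂ LonelyRunner.SStar 1 3) :=
  ⟨⟨LonelyRunner.isClosedSubgroupOfDim_witness, LonelyRunner.isProper_witness,
      LonelyRunner.D_witness⟩,
    ⟨⟨LonelyRunner.witness, LonelyRunner.isClosedSubgroupOfDim_witness,
      LonelyRunner.isProper_witness, LonelyRunner.D_witness⟩,
      LonelyRunner.seven_div_fifty_not_mem_S_one_three⟩,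
    LonelyRunner.seven_div_fifty_mem_SStar_one_three,
    LonelyRunner.S_one_subset_SStar_one 3, fun h =>
      LonelyRunner.seven_div_fifty_not_mem_S_one_three
        (h LonelyRunner.seven_div_fifty_mem_SStar_one_three)⟩
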